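/- Let $\mathbb F=\mathbb R$ or $\mathbb C$ and let $\mathcal A$ be a nonzero unital $C^*$-algebra over $\mathbb F$: a unital Banach $*$-algebra over $\mathbb F$ with $\|x^*x\|=\|x\|^2$ for all $x$ and, if $\mathbb F=\mathbb R$, with $1_{\mathcal A}+x^*x$ invertible for all $x$. A state on $\mathcal A$ is an $\mathbb F$-linear functional $\phi:\mathcal A\to\mathbb F$ with $\phi(1_{\mathcal A})=1$ that takes positive elements (those of the form $y^*y$) to non-negative real numbers and, if $\mathbb F=\mathbb R$, also satisfies $\phi(x^*)=\phi(x)$ for all $x\in\mathcal A$. A cyclic representation $(\mathcal H,\pi,\xi)$ of $\mathcal A$ consists of a Hilbert space $\mathcal H$ over $\mathbb F$, a $*$-algebra homomorphism $\pi$ from $\mathcal A$ to the algebra $\mathscr B(\mathcal H)$ of bounded operators with $\pi(1_{\mathcal A})=1$, and a unit vector $\xi\in\mathcal H$ such that $\{\pi(x)\xi : x\in\mathcal A\}$ is dense in $\mathcal H$. Let $a\in\mathcal A$ and let $\mathcal B$ be an $\mathbb F$-linear subspace of $\mathcal A$. Then the following are equivalent. 1. $a$ is Birkhoff–James orthogonal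 to $\mathcal B$, that is, $\|a\|\le\|a+kb\|$ for all $b\in\mathcal B$ and all $k\in\mathbb F$. 2. There exists a state $\phi$ on $\mathcal A$ such that $\phi(a^*a)=\|a\|^2$ and $\phi(a^*b)=0$ for all $b\in\mathcal B$. 3. There exists a cyclic representation $(\mathcal H,\pi,\xi)$ of $\mathcal A$ such that $\|\pi(a)\xi\|=\|a\|$ and $\langle\pi(a)\xi\,|\,\pi(b)\xi\rangle=0$ for all $b\in\mathcal B$. -/

import Mathlib

universe u v

/-- `v` is Birkhoff-James orthogonal to `u` (over the scalar field `𝕜`). -/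
def IsBJOrthogonal (𝕜 : Type*) {V : Type*} [RCLike 𝕜] [NormedAddCommGroup V] [NormedSpace 𝕜 V]
    (v u : V) : Prop :=
  ∀ k : 𝕜, ‖v‖ ≤ ‖v + k • u‖

/-- `v` is Birkhoff-James orthogonal to the subspace `W`. -/
def IsBJOrthogonalTo {𝕜 V : Type*} [RCLike 𝕜] [NormedAddCommGroup V] [NormedSpace 𝕜 V]
    (v : V) (W : Submodule 𝕜 V) : Prop :=
  ∀ w ∈ W, IsBJOrthogonal 𝕜 v w

/-- A unital Banach *-algebra over `𝕜` (`ℝ` or `ℂ`) with the C*-identity is a unital C*-algebra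
over `𝕜` if, in the real case (where `RCLike.I = 0`), also `1 + x* x` is invertible for every `x`.
Over `ℂ` this is automatic; over `ℝ` it is part of the definition of a C*-algebra (it excludes, for
instance, `ℂ` as a real algebra with the identity as involution). -/
class IsUnitalCStarAlgebra (𝕜 A : Type*) [RCLike 𝕜] [NormedRing A] [StarRing A] [CompleteSpace A]
    [CStarRing A] [NormedAlgebra 𝕜 A] [StarModule 𝕜 A] : Prop where
  isUnit_one_add_star_mul_self :
    (RCLike.I : 𝕜) = 0 → ∀ x : A, IsUnit (1 + star x * x)

/-- The positive elements of a C*-algebra: those of the form `y* y`. -/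
def IsPositiveElement {A : Type*} [NormedRing A] [StarRing A] (x : A) : Prop :=
  ∃ y : A, x = star y * y

/-- States: linear functionals that take `1` to `1` and positive elements to non-negative real
numbers, and that in the real case (`RCLike.I = 0`) also satisfy `φ (x*) = φ x`. -/
structure IsState {𝕜 A : Type*} [RCLike 𝕜] [NormedRing A] [StarRing A] [NormedAlgebra 𝕜 A]
    (φ : A →ₗ[𝕜] 𝕜) : Prop where
  map_one : φ 1 = 1
  map_nonneg : ∀ x : A, IsPositiveElement x → ∃ r : ℝ, 0 ≤ r ∧ φ x = (r : 𝕜)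
  map_star_of_real : (RCLike.I : 𝕜) = 0 → ∀ x : A, φ (star x) = φ x

/-- `(H, π, ξ)` is a cyclic representation: `π` is a unital *-homomorphism into the bounded
operators on the Hilbert space `H` (unitality is part of `→⋆ₐ`), and `ξ` is a unit vector whose
orbit is dense in `H`. -/
structure IsCyclicRepresentation {𝕜 A H : Type*} [RCLike 𝕜] [NormedRing A] [StarRing A]
    [NormedAlgebra 𝕜 A] [NormedAddCommGroup H] [InnerProductSpace 𝕜 H] [CompleteSpace H]
    (π : A →⋆ₐ[𝕜] (H →L[𝕜] H)) (ξ : H) : Prop where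
  norm_eq_one : ‖ξ‖ = 1
  dense_orbit : Dense {η : H | ∃ x : A, η = π x ξ}

/-!
If `a` is Birkhoff–James orthogonal to `B`, then expanding `‖a + ε b‖² = ‖(a + ε b)* (a + ε b)‖` to
first order in `ε` shows that `t + s a* a + a* b ↦ t + s ‖a‖²`, for scalars `t`, `s` and `b ∈ B`,
is a well-defined functional of norm at most one. A norm-preserving Hahn–Banach extension `φ`
satisfies `‖φ‖ = φ 1 = 1` and is therefore a state. The Gelfand–Naimark–Segal construction turns a
state into a cyclic representation with `⟪π a ξ, π b ξ⟫ = φ (a* b)`, and in any such representation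
orthogonality in `A` follows from Pythagoras' theorem and `‖π x‖ ≤ ‖x‖`.

The order structure of a real C*-algebra rests on the fact that a selfadjoint `h` has `‖h‖` or
`-‖h‖` in its real spectrum. The right regular representation on the complex-valued dual embeds the
algebra isometrically into a complex Banach algebra, where the spectral radius formula applies, and
invertibility of `1 + x* x` forces the spectrum of `h` to be real. An algebra over a general `𝕜` is
treated as a real one by restriction of scalars.
-/

section Spectrum

open Polynomial in
theorem im_eq_zero_of_mem_spectrum {E : Type*} [Ring E] [Algebra ℂ E] {b : E}
    (hb : ∀ r s : ℝ, s ≠ 0 →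
      IsUnit ((b - algebraMap ℂ E r) ^ 2 + algebraMap ℂ E ((s ^ 2 : ℝ) : ℂ)))
    {z : ℂ} (hz : z ∈ spectrum ℂ b) : z.im = 0 := by
  by_contra him
  let p : ℂ[X] := (X - C (z.re : ℂ)) ^ 2 + C ((z.im ^ 2 : ℝ) : ℂ)
  have hp : p.eval z = 0 := by
    have hzre : z - z.re = z.im * Complex.I := by
      rw [sub_eq_iff_eq_add', Complex.re_add_im]
    simp [p, hzre, mul_pow]
  have hzero : (0 : ℂ) ∈ spectrum ℂ (aeval b p) :=
    spectrum.subset_polynomial_aeval b p ⟨z, hz, hp⟩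
  rw [spectrum.zero_mem_iff] at hzero
  exact hzero (by simpa [p] using hb z.re z.im him)

theorem spectralRadius_eq_nnnorm_of_nnnorm_pow_two_pow {E : Type*} [NormedRing E]
    [NormedAlgebra ℂ E] [CompleteSpace E] {b : E}
    (hb : ∀ n : ℕ, ‖b ^ 2 ^ n‖₊ = ‖b‖₊ ^ 2 ^ n) : spectralRadius ℂ b = ‖b‖₊ := by
  have hlim := (spectrum.pow_nnnorm_pow_one_div_tendsto_nhds_spectralRadius b).comp
    (tendsto_pow_atTop_atTop_of_one_lt one_lt_two)
  refine tendsto_nhds_unique hlim (tendsto_const_nhds.congr fun n => ?_)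
  rw [Function.comp_apply, hb, ENNReal.coe_pow, ← ENNReal.rpow_natCast, ← ENNReal.rpow_mul]
  simp

end Spectrum

section ComplexRegularRepresentation

variable {A : Type*} [NormedRing A] [NormedAlgebra ℝ A]

/-- The action of `a` on the complex-valued dual of a real normed algebra by
`(a • f) x = f (x a)`. -/
noncomputable def dualRightMul (a : A) : (A →L[ℝ] ℂ) →L[ℂ] (A →L[ℝ] ℂ) :=
  LinearMap.mkContinuous
    { toFun f := f.comp ((ContinuousLinearMap.mul ℝ A).flip a)
      map_add' _ _ := rfl
      map_smul' _ _ := rfl } ‖a‖ fun f => by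
    refine ContinuousLinearMap.opNorm_le_bound _ (by positivity) fun x => ?_
    calc ‖f (x * a)‖ ≤ ‖f‖ * (‖x‖ * ‖a‖) := f.le_opNorm_of_le (norm_mul_le x a)
      _ = ‖a‖ * ‖f‖ * ‖x‖ := by ring

@[simp]
theorem dualRightMul_apply (a : A) (f : A →L[ℝ] ℂ) (x : A) : dualRightMul a f x = f (x * a) := rfl

variable (A) in
/-- The right regular representation of a real normed algebra on its complex-valued dual. It embeds
`A` into a complex Banach algebra, which makes complex spectral theory available in `A`. -/
noncomputable def complexRegularRep : A →ₐ[ℝ] ((A →L[ℝ] ℂ) →L[ℂ] (A →L[ℝ] ℂ)) :=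
  AlgHom.ofLinearMap
    { toFun := dualRightMul
      map_add' a b := by ext f x; simp [mul_add]
      map_smul' c a := by ext f x; simp }
    (by ext f x; simp)
    (fun a b => by ext f x; simp [mul_assoc])

theorem complexRegularRep_apply (a : A) (f : A →L[ℝ] ℂ) (x : A) :
    complexRegularRep A a f x = f (x * a) := rfl

theorem norm_complexRegularRep [NormOneClass A] (a : A) : ‖complexRegularRep A a‖ = ‖a‖ := by
  have hle : ‖dualRightMul a‖ ≤ ‖a‖ := LinearMap.mkContinuous_norm_le _ (norm_nonneg a) _
  refine le_antisymm hle ?_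
  obtain ⟨g, hg, hga⟩ := exists_dual_vector'' ℝ a
  let f : A →L[ℝ] ℂ := Complex.ofRealCLM.comp g
  have hf : ‖f‖ ≤ 1 :=
    f.opNorm_le_bound zero_le_one fun x => by simpa [f] using g.le_of_opNorm_le hg x
  calc ‖a‖ = ‖complexRegularRep A a f 1‖ := by simp [complexRegularRep_apply, f, hga]
    _ ≤ ‖complexRegularRep A a f‖ := by
      simpa using (complexRegularRep A a f).le_opNorm 1
    _ ≤ ‖complexRegularRep A a‖ * ‖f‖ := (complexRegularRep A a).le_opNorm f
    _ ≤ ‖complexRegularRep A a‖ :=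
      mul_le_of_le_one_right (norm_nonneg (complexRegularRep A a)) hf

theorem isometry_complexRegularRep [NormOneClass A] : Isometry (complexRegularRep A) :=
  AddMonoidHomClass.isometry_of_norm (complexRegularRep A).toLinearMap norm_complexRegularRep

end ComplexRegularRepresentation

section RealCStarAlgebra

variable {A : Type*} [NormedRing A] [StarRing A] [CompleteSpace A] [CStarRing A]
  [NormedAlgebra ℝ A] [StarModule ℝ A] [IsUnitalCStarAlgebra ℝ A]

theorem isUnit_algebraMap_add_star_mul_self {t : ℝ} (ht : 0 < t) (y : A) :
    IsUnit (algebraMap ℝ A t + star y * y) := by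
  have hunit : IsUnit (1 + star ((√t)⁻¹ • y) * ((√t)⁻¹ • y)) :=
    IsUnitalCStarAlgebra.isUnit_one_add_star_mul_self (𝕜 := ℝ) rfl _
  have hscale : t * ((√t)⁻¹ * (√t)⁻¹) = 1 := by
    rw [← mul_inv, Real.mul_self_sqrt ht.le, mul_inv_cancel₀ ht.ne']
  convert ((IsUnit.mk0 t ht.ne').map (algebraMap ℝ A)).mul hunit using 1
  rw [mul_add, mul_one, star_smul, star_trivial (√t)⁻¹, smul_mul_smul_comm, ← Algebra.smul_def,
    smul_smul, hscale, one_smul]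

theorem nonneg_of_mem_spectrum_star_mul_self {y : A} {r : ℝ} (hr : r ∈ spectrum ℝ (star y * y)) :
    0 ≤ r := by
  by_contra! hneg
  refine spectrum.mem_iff.1 hr ?_
  simpa [neg_add_eq_sub] using (isUnit_algebraMap_add_star_mul_self (neg_pos.2 hneg) y).neg

theorem im_eq_zero_of_mem_spectrum_map {E : Type*} [Ring E] [Algebra ℂ E] [Algebra ℝ E]
    [IsScalarTower ℝ ℂ E] (T : A →ₐ[ℝ] E) {h : A} (hh : IsSelfAdjoint h) {z : ℂ}
    (hz : z ∈ spectrum ℂ (T h)) : z.im = 0 := by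
  refine im_eq_zero_of_mem_spectrum (fun r s hs => ?_) hz
  have hsa : IsSelfAdjoint (h - algebraMap ℝ A r) := hh.sub (.algebraMap A (.all r))
  have hunit := isUnit_algebraMap_add_star_mul_self (sq_pos_of_ne_zero hs) (h - algebraMap ℝ A r)
  rw [hsa.star_eq, ← sq, add_comm] at hunit
  simpa only [map_add, map_pow, map_sub, AlgHom.commutes, IsScalarTower.algebraMap_apply ℝ ℂ E,
    Complex.coe_algebraMap, Complex.ofReal_pow] using hunit.map T

variable [Nontrivial A]

theorem norm_mem_spectrum_or_neg_norm_mem_spectrum_of_isometry {E : Type*} [NormedRing E]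
    [NormedAlgebra ℂ E] [Algebra ℝ E] [IsScalarTower ℝ ℂ E] [CompleteSpace E] (T : A →ₐ[ℝ] E)
    (hT : Isometry T) {h : A} (hh : IsSelfAdjoint h) :
    ‖h‖ ∈ spectrum ℝ h ∨ -‖h‖ ∈ spectrum ℝ h := by
  have : Nontrivial E := hT.injective.nontrivial
  have hnorm : ∀ x, ‖T x‖₊ = ‖x‖₊ := hT.nnnorm_map_of_map_zero (map_zero T)
  have hradius : spectralRadius ℂ (T h) = ‖h‖₊ := by
    rw [← hnorm h]
    exact spectralRadius_eq_nnnorm_of_nnnorm_pow_two_pow fun n => by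
      rw [← map_pow, hnorm, hnorm, hh.nnnorm_pow_two_pow]
  obtain ⟨z, hz, hzradius⟩ := spectrum.exists_nnnorm_eq_spectralRadius (T h)
  have hzreal : algebraMap ℝ ℂ z.re = z :=
    Complex.ext rfl (im_eq_zero_of_mem_spectrum_map T hh hz).symm
  have hznorm : |z.re| = ‖h‖ := by
    rw [hradius, ENNReal.coe_inj] at hzradius
    rw [← Real.norm_eq_abs, ← norm_algebraMap' ℂ z.re, hzreal]
    exact congrArg NNReal.toReal hzradius
  have hmem : z.re ∈ spectrum ℝ h := by
    rw [← hzreal, spectrum.algebraMap_mem_iff] at hz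
    exact AlgHom.spectrum_apply_subset T h hz
  rcases abs_choice z.re with habs | habs
  · left; rwa [← hznorm, habs]
  · right; rwa [← hznorm, habs, neg_neg]

theorem norm_mem_spectrum_or_neg_norm_mem_spectrum {h : A} (hh : IsSelfAdjoint h) :
    ‖h‖ ∈ spectrum ℝ h ∨ -‖h‖ ∈ spectrum ℝ h :=
  norm_mem_spectrum_or_neg_norm_mem_spectrum_of_isometry
    (E := (A →L[ℝ] ℂ) →L[ℂ] (A →L[ℝ] ℂ)) (complexRegularRep A) isometry_complexRegularRep hh

theorem norm_sq_mem_spectrum_star_mul_self (y : A) : ‖y‖ ^ 2 ∈ spectrum ℝ (star y * y) := by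
  rw [sq, ← CStarRing.norm_star_mul_self]
  rcases norm_mem_spectrum_or_neg_norm_mem_spectrum (.star_mul_self y) with h | h
  · exact h
  · have hzero : ‖star y * y‖ = 0 :=
      le_antisymm (neg_nonneg.1 (nonneg_of_mem_spectrum_star_mul_self h)) (norm_nonneg _)
    rwa [hzero, neg_zero, ← hzero] at h

theorem add_norm_sq_le_norm_algebraMap_add_star_mul_self (t : ℝ) (y : A) :
    t + ‖y‖ ^ 2 ≤ ‖algebraMap ℝ A t + star y * y‖ :=
  have hmem : ‖y‖ ^ 2 + t ∈ spectrum ℝ (algebraMap ℝ A t + star y * y) :=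
    spectrum.add_mem_add_iff.2 (norm_sq_mem_spectrum_star_mul_self y)
  add_comm t _ ▸ (le_abs_self _).trans (spectrum.norm_le_norm_of_mem hmem)

theorem norm_algebraMap_sub_star_mul_self_le (y : A) :
    ‖algebraMap ℝ A (‖y‖ ^ 2) - star y * y‖ ≤ ‖y‖ ^ 2 := by
  have hsa : IsSelfAdjoint (algebraMap ℝ A (‖y‖ ^ 2) - star y * y) :=
    (IsSelfAdjoint.algebraMap A (.all _)).sub (.star_mul_self y)
  have hspec := norm_mem_spectrum_or_neg_norm_mem_spectrum hsa
  simp only [← spectrum.singleton_sub_eq, Set.singleton_sub, Set.mem_image] at hspec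
  rcases hspec with ⟨r, hr, heq⟩ | ⟨r, hr, heq⟩
  · have := nonneg_of_mem_spectrum_star_mul_self hr
    linarith
  · have : |r| ≤ ‖y‖ ^ 2 := by
      simpa [CStarRing.norm_star_mul_self, sq] using spectrum.norm_le_norm_of_mem hr
    linarith [le_abs_self r, sq_nonneg ‖y‖]

open Filter Topology in
theorem IsBJOrthogonal.add_mul_norm_sq_le_norm {a b : A} (hab : IsBJOrthogonal ℝ a b) (s t : ℝ) :
    t + s * ‖a‖ ^ 2 ≤ ‖algebraMap ℝ A t + s • (star a * a) + (star a * b + star b * a)‖ := by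
  set x := algebraMap ℝ A t + s • (star a * a) + (star a * b + star b * a)
  -- The estimate for `a + ε b`, expanded and divided by `ε`.
  have hbound : ∀ ε : ℝ, 0 < ε → ε * s < 1 → t + s * ‖a‖ ^ 2 ≤ ‖x‖ + ε * ‖b‖ ^ 2 := by
    intro ε hε hεs
    have hexpand : algebraMap ℝ A (ε * t) + star (a + ε • b) * (a + ε • b) =
        ε • x + (1 - ε * s) • (star a * a) + ε ^ 2 • (star b * b) := by
      simp only [x, Algebra.algebraMap_eq_smul_one, star_add, star_smul, star_trivial ε, add_mul,
        mul_add, smul_mul_assoc, mul_smul_comm]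
      module
    refine le_of_mul_le_mul_left ?_ hε
    have : ε * t + ‖a‖ ^ 2 ≤ ε * ‖x‖ + (1 - ε * s) * ‖a‖ ^ 2 + ε ^ 2 * ‖b‖ ^ 2 := calc
      ε * t + ‖a‖ ^ 2 ≤ ε * t + ‖a + ε • b‖ ^ 2 := by gcongr; exact hab ε
      _ ≤ ‖algebraMap ℝ A (ε * t) + star (a + ε • b) * (a + ε • b)‖ :=
        add_norm_sq_le_norm_algebraMap_add_star_mul_self _ _
      _ ≤ ‖ε • x‖ + ‖(1 - ε * s) • (star a * a)‖ + ‖ε ^ 2 • (star b * b)‖ := by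
        rw [hexpand]; exact norm_add₃_le
      _ = ε * ‖x‖ + (1 - ε * s) * ‖a‖ ^ 2 + ε ^ 2 * ‖b‖ ^ 2 := by
        simp only [norm_smul, CStarRing.norm_star_mul_self, Real.norm_of_nonneg hε.le,
          Real.norm_of_nonneg (sub_pos.2 hεs).le, Real.norm_of_nonneg (sq_nonneg ε), ← sq]
    linarith
  have hlim : Tendsto (fun ε : ℝ => ‖x‖ + ε * ‖b‖ ^ 2) (𝓝[>] 0) (𝓝 ‖x‖) :=
    (Continuous.tendsto' (by fun_prop) _ _ (by simp)).mono_left nhdsWithin_le_nhds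
  have hsmall : ∀ᶠ ε : ℝ in 𝓝[>] 0, ε * s < 1 :=
    nhdsWithin_le_nhds <| (continuous_mul_const s).tendsto' 0 0 (zero_mul s) |>.eventually_lt_const
      one_pos
  refine ge_of_tendsto hlim ?_
  filter_upwards [self_mem_nhdsWithin, hsmall] with ε hε hεs using hbound ε hε hεs

end RealCStarAlgebra

theorem isUnit_one_add_star_mul_self_of_cstarAlgebra {A : Type*} [CStarAlgebra A]
    (x : A) : IsUnit (1 + star x * x) := by
  have hmem : (-1 : ℝ) ∉ spectrum ℝ (star x * x) := fun h => by
    linarith [spectrum_star_mul_self_nonneg (-1) h]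
  simpa [add_comm] using (spectrum.notMem_iff.1 hmem).neg

section Scalars

variable (𝕜 : Type*) {A : Type*} [RCLike 𝕜] [NormedRing A] [StarRing A] [CompleteSpace A]
  [CStarRing A] [NormedAlgebra 𝕜 A] [StarModule 𝕜 A]

theorem isUnit_one_add_star_mul_self_of_im_I_eq_one (hI : RCLike.im (RCLike.I : 𝕜) = 1) (x : A) :
    IsUnit (1 + star x * x) := by
  let r : ℂ →+* 𝕜 := (RCLike.complexRingEquiv hI).symm.toRingHom
  have hnorm : ∀ z, ‖r z‖ = ‖z‖ := (RCLike.complexLinearIsometryEquiv hI).symm.norm_map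
  have hstar : ∀ z, r (star z) = star (r z) := fun z => by
    simp [r, RCLike.complexRingEquiv]
  let _ : Algebra ℂ A := Algebra.compHom A r
  have hsmul : ∀ (z : ℂ) (y : A), z • y = r z • y := fun _ _ => rfl
  let _ : NormedAlgebra ℂ A :=
    { norm_smul_le := fun z y => by rw [hsmul, norm_smul, hnorm] }
  have : StarModule ℂ A := ⟨fun z y => by rw [hsmul, hsmul, star_smul, hstar]⟩
  let _ : CStarAlgebra A := { }
  exact isUnit_one_add_star_mul_self_of_cstarAlgebra x

theorem IsUnitalCStarAlgebra.isUnit [IsUnitalCStarAlgebra 𝕜 A] (x : A) :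
    IsUnit (1 + star x * x) :=
  (RCLike.I_eq_zero_or_im_I_eq_one (K := 𝕜)).elim
    (IsUnitalCStarAlgebra.isUnit_one_add_star_mul_self · x)
    (isUnit_one_add_star_mul_self_of_im_I_eq_one 𝕜 · x)

theorem IsUnitalCStarAlgebra.real [IsUnitalCStarAlgebra 𝕜 A] [NormedAlgebra ℝ A]
    [StarModule ℝ A] : IsUnitalCStarAlgebra ℝ A :=
  ⟨fun _ => IsUnitalCStarAlgebra.isUnit 𝕜⟩

end Scalars

theorem starModule_real (𝕜 : Type*) {E : Type*} [RCLike 𝕜] [AddCommGroup E] [Star E]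
    [Module 𝕜 E] [StarModule 𝕜 E] [Module ℝ E] [IsScalarTower ℝ 𝕜 E] : StarModule ℝ E :=
  ⟨fun r x => by
    rw [← algebraMap_smul 𝕜 r x, ← algebraMap_smul 𝕜 (star r) (star x), star_smul]
    simp⟩

theorem norm_le_norm_of_re_le_norm {𝕜 M E : Type*} [RCLike 𝕜] [AddCommGroup M] [Module 𝕜 M]
    [NormedAddCommGroup E] [NormedSpace 𝕜 E] {T : M →ₗ[𝕜] E} {g : M →ₗ[𝕜] 𝕜}
    (h : ∀ m, RCLike.re (g m) ≤ ‖T m‖) (m : M) : ‖g m‖ ≤ ‖T m‖ := by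
  obtain ⟨c, hc, hcm⟩ := RCLike.exists_norm_eq_mul_self (g m)
  calc ‖g m‖ = RCLike.re (g (c • m)) := by rw [map_smul, smul_eq_mul, ← hcm, RCLike.ofReal_re]
    _ ≤ ‖T (c • m)‖ := h _
    _ = ‖T m‖ := by rw [map_smul, norm_smul, hc, one_mul]

theorem exists_dual_comp_eq_of_re_le_norm {𝕜 M E : Type*} [RCLike 𝕜] [AddCommGroup M]
    [Module 𝕜 M] [NormedAddCommGroup E] [NormedSpace 𝕜 E] (T : M →ₗ[𝕜] E) (g : M →ₗ[𝕜] 𝕜)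
    (h : ∀ m, RCLike.re (g m) ≤ ‖T m‖) :
    ∃ φ : E →L[𝕜] 𝕜, ‖φ‖ ≤ 1 ∧ ∀ m, φ (T m) = g m := by
  have hle := norm_le_norm_of_re_le_norm h
  have hker : g ∈ T.ker.dualAnnihilator := (Submodule.mem_dualAnnihilator g).2 fun m hm =>
    norm_le_zero_iff.1 <| by simpa [LinearMap.mem_ker.1 hm] using hle m
  rw [← LinearMap.range_dualMap_eq_dualAnnihilator_ker] at hker
  obtain ⟨f, rfl⟩ := hker
  let f₀ : T.range →L[𝕜] 𝕜 := (f.domRestrict T.range).mkContinuous 1 <| by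
    rintro ⟨_, m, rfl⟩
    simpa using hle m
  obtain ⟨φ, hφ, hnorm⟩ := exists_extension_norm_eq T.range f₀
  exact ⟨φ, hnorm ▸ LinearMap.mkContinuous_norm_le _ zero_le_one _, fun m => hφ ⟨T m, m, rfl⟩⟩

theorem norm_one_add_sq_le_of_star_eq_neg {A : Type*} [NormedRing A] [StarRing A] [CStarRing A]
    [Nontrivial A] {x : A} (hx : star x = -x) : ‖1 + x‖ ^ 2 ≤ 1 + ‖x‖ ^ 2 := by
  have hexpand : star (1 + x) * (1 + x) = 1 - x ^ 2 := by
    rw [star_add, star_one, hx]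
    noncomm_ring
  calc ‖1 + x‖ ^ 2 = ‖1 - x ^ 2‖ := by rw [sq, ← CStarRing.norm_star_mul_self, hexpand]
    _ ≤ ‖(1 : A)‖ + ‖x‖ ^ 2 := (norm_sub_le _ _).trans (by gcongr; exact norm_pow_le' x two_pos)
    _ = 1 + ‖x‖ ^ 2 := by rw [norm_one]

section NormOneFunctional

variable {𝕜 A : Type*} [RCLike 𝕜] [NormedRing A] [StarRing A] [CStarRing A] [Nontrivial A]
  [NormedAlgebra 𝕜 A] [StarModule 𝕜 A] {φ : A →L[𝕜] 𝕜}

theorem re_map_eq_zero_of_star_eq_neg (hφ : ‖φ‖ ≤ 1) (h1 : φ 1 = 1) {k : A}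
    (hk : star k = -k) : RCLike.re (φ k) = 0 := by
  set c := RCLike.re (φ k)
  have hbound : ∀ ε : ℝ, 2 * ε * c ≤ ε ^ 2 * ‖k‖ ^ 2 := fun ε => by
    have hre : |1 + ε * c| ≤ ‖1 + (ε : 𝕜) • k‖ := by
      simpa [h1, c] using
        (RCLike.abs_re_le_norm _).trans (φ.le_of_opNorm_le hφ (1 + (ε : 𝕜) • k))
    have hsq := norm_one_add_sq_le_of_star_eq_neg (x := (ε : 𝕜) • k) <| by
      rw [star_smul, RCLike.star_def, RCLike.conj_ofReal, hk, smul_neg]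
    rw [norm_smul, mul_pow, RCLike.norm_ofReal, sq_abs] at hsq
    linarith [sq_nonneg (ε * c), sq_le_sq.2 (hre.trans (le_abs_self _))]
  have hpos : 0 < ‖k‖ ^ 2 + 1 := by positivity
  have := hbound (c / (‖k‖ ^ 2 + 1))
  field_simp at this
  nlinarith

theorem map_star_of_norm_le_one (hφ : ‖φ‖ ≤ 1) (h1 : φ 1 = 1) (x : A) :
    φ (star x) = star (φ x) := by
  have hre : ∀ y, RCLike.re (φ (star y)) = RCLike.re (φ y) := fun y => by
    have := re_map_eq_zero_of_star_eq_neg hφ h1 (k := star y - y) (by simp)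
    rwa [map_sub, map_sub, sub_eq_zero] at this
  refine RCLike.ext (by simp [hre]) ?_
  simpa [star_smul] using hre ((RCLike.I : 𝕜) • x)

end NormOneFunctional

section BirkhoffJames

variable {𝕜 A : Type*} [RCLike 𝕜] [NormedRing A] [StarRing A] [CompleteSpace A] [CStarRing A]
  [NormedAlgebra 𝕜 A] [StarModule 𝕜 A] [IsUnitalCStarAlgebra 𝕜 A] [Nontrivial A]

theorem isState_of_norm_le_one {φ : A →L[𝕜] 𝕜} (hφ : ‖φ‖ ≤ 1) (h1 : φ 1 = 1) :
    IsState (φ : A →ₗ[𝕜] 𝕜) where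
  map_one := h1
  map_nonneg := by
    rintro _ ⟨y, rfl⟩
    let _ : NormedAlgebra ℝ A := NormedAlgebra.restrictScalars ℝ 𝕜 A
    have : IsScalarTower ℝ 𝕜 A := IsScalarTower.of_algebraMap_smul fun _ _ => rfl
    have : StarModule ℝ A := starModule_real 𝕜
    have : IsUnitalCStarAlgebra ℝ A := .real 𝕜
    have hstar : star (φ (star y * y)) = φ (star y * y) := by
      rw [← map_star_of_norm_le_one hφ h1, star_mul, star_star]
    have hreal : ((RCLike.re (φ (star y * y)) : ℝ) : 𝕜) = φ (star y * y) :=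
      RCLike.conj_eq_iff_re.1 hstar
    refine ⟨RCLike.re (φ (star y * y)), ?_, hreal.symm⟩
    have hle := (RCLike.re_le_norm _).trans <|
      (φ.le_of_opNorm_le hφ _).trans <| (one_mul _).trans_le <|
        norm_algebraMap_sub_star_mul_self_le y
    have hmap : φ (algebraMap ℝ A (‖y‖ ^ 2)) = ((‖y‖ ^ 2 : ℝ) : 𝕜) := by
      rw [IsScalarTower.algebraMap_apply ℝ 𝕜 A, Algebra.algebraMap_eq_smul_one, map_smul, h1,
        smul_eq_mul, mul_one, RCLike.algebraMap_eq_ofReal]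
    rw [map_sub, map_sub, hmap, RCLike.ofReal_re] at hle
    linarith
  map_star_of_real hI x :=
    (map_star_of_norm_le_one hφ h1 x).trans <|
      RCLike.conj_eq_iff_im.2 (RCLike.im_eq_zero hI _)

theorem IsBJOrthogonal.re_add_mul_norm_sq_le_norm {a b : A} (hab : IsBJOrthogonal 𝕜 a b)
    (t s : 𝕜) : RCLike.re (t + s * (‖a‖ ^ 2 : ℝ)) ≤
      ‖algebraMap 𝕜 A t + s • (star a * a) + star a * b‖ := by
  let _ : NormedAlgebra ℝ A := NormedAlgebra.restrictScalars ℝ 𝕜 A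
  have : IsScalarTower ℝ 𝕜 A := IsScalarTower.of_algebraMap_smul fun _ _ => rfl
  have : StarModule ℝ A := starModule_real 𝕜
  have : IsUnitalCStarAlgebra ℝ A := .real 𝕜
  have hreal : IsBJOrthogonal ℝ a b := fun r => by
    simpa only [← algebraMap_smul 𝕜 r b] using hab (algebraMap ℝ 𝕜 r)
  set x := algebraMap 𝕜 A t + s • (star a * a) + star a * b
  have hsum : ∀ z : 𝕜, ∀ w : A, z • w + star z • w = (2 * RCLike.re z) • w := fun z w => by
    rw [← add_smul, RCLike.star_def, RCLike.add_conj, ← algebraMap_smul 𝕜 (2 * RCLike.re z) w]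
    rw [map_mul, map_ofNat, RCLike.algebraMap_eq_ofReal]
  have hx : x + star x = algebraMap ℝ A (2 * RCLike.re t) +
      (2 * RCLike.re s) • (star a * a) + (star a * b + star b * a) := by
    simp only [x, Algebra.algebraMap_eq_smul_one, ← hsum, star_add, star_smul, star_one, star_mul,
      star_star]
    abel
  -- The real inequality for `x + x*`, whose norm is at most `2 ‖x‖`.
  have h := hreal.add_mul_norm_sq_le_norm (2 * RCLike.re s) (2 * RCLike.re t)
  rw [← hx] at h
  have hnorm := norm_add_le x (star x)
  rw [norm_star] at hnorm
  rw [map_add, RCLike.re_mul_ofReal]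
  linarith

theorem IsBJOrthogonalTo.exists_isState {a : A} {B : Submodule 𝕜 A} (h : IsBJOrthogonalTo a B) :
    ∃ φ : A →ₗ[𝕜] 𝕜, IsState φ ∧ φ (star a * a) = ((‖a‖ ^ 2 : ℝ) : 𝕜) ∧
      ∀ b ∈ B, φ (star a * b) = 0 := by
  let T : 𝕜 × 𝕜 × B →ₗ[𝕜] A := (Algebra.linearMap 𝕜 A).coprod <|
    (LinearMap.toSpanSingleton 𝕜 A (star a * a)).coprod (LinearMap.mulLeft 𝕜 (star a) ∘ₗ B.subtype)
  let g : 𝕜 × 𝕜 × B →ₗ[𝕜] 𝕜 := LinearMap.id.coprod <|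
    (LinearMap.toSpanSingleton 𝕜 𝕜 ((‖a‖ ^ 2 : ℝ) : 𝕜)).coprod 0
  obtain ⟨φ, hφ, hφT⟩ := exists_dual_comp_eq_of_re_le_norm T g <| by
    rintro ⟨t, s, b, hb⟩
    simpa [T, g, add_assoc] using (h b hb).re_add_mul_norm_sq_le_norm t s
  refine ⟨φ, isState_of_norm_le_one hφ ?_, ?_, fun b hb => ?_⟩
  · simpa [T, g] using hφT (1, 0, 0)
  · simpa [T, g] using hφT (0, 1, 0)
  · simpa [T, g] using hφT (0, 0, ⟨b, hb⟩)

end BirkhoffJames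

section SquareRoot

variable {A : Type*} [NormedRing A] [NormedAlgebra ℝ A] [StarRing A] [NormedStarGroup A]
  [StarModule ℝ A] [CompleteSpace A]

theorem exists_isSelfAdjoint_two_smul_eq_add_mul_self {h : A} (hh : IsSelfAdjoint h)
    (hlt : ‖h‖ < 1) : ∃ u : A, IsSelfAdjoint u ∧ (2 : ℝ) • u = h + u * u := by
  -- `u` is the fixed point of a contraction of the closed ball of radius `‖h‖`.
  let f : A → A := fun u => (2⁻¹ : ℝ) • (h + u * u)
  let s : Set A := {u | ‖u‖ ≤ ‖h‖ ∧ IsSelfAdjoint u}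
  have hcomplete : IsComplete s := IsClosed.isComplete <|
    (isClosed_le continuous_norm continuous_const).inter
      (isClosed_eq continuous_star continuous_id)
  have hmaps : Set.MapsTo f s s := by
    rintro u ⟨hu, husa⟩
    refine ⟨?_, .smul (.all _) (hh.add (by simpa [sq] using husa.pow 2))⟩
    calc ‖f u‖ ≤ 2⁻¹ * (‖h‖ + ‖u‖ * ‖u‖) := by
          rw [norm_smul, norm_inv, Real.norm_two]
          gcongr
          exact norm_add_le_of_le le_rfl (norm_mul_le u u)
      _ ≤ 2⁻¹ * (‖h‖ + 1 * ‖h‖) := by gcongr; exact hu.trans hlt.le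
      _ = ‖h‖ := by ring
  have hlip : ∀ u ∈ s, ∀ v ∈ s, ‖f u - f v‖ ≤ ‖h‖ * ‖u - v‖ := by
    rintro u ⟨hu, -⟩ v ⟨hv, -⟩
    have hsub : f u - f v = (2⁻¹ : ℝ) • (u * (u - v) + (u - v) * v) := by
      simp only [f, mul_sub, sub_mul]
      module
    calc ‖f u - f v‖ ≤ 2⁻¹ * (‖u‖ * ‖u - v‖ + ‖u - v‖ * ‖v‖) := by
          rw [hsub, norm_smul, norm_inv, Real.norm_two]
          gcongr
          exact norm_add_le_of_le (norm_mul_le _ _) (norm_mul_le _ _)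
      _ ≤ 2⁻¹ * (‖h‖ * ‖u - v‖ + ‖u - v‖ * ‖h‖) := by gcongr
      _ = ‖h‖ * ‖u - v‖ := by ring
  have hcontract : ContractingWith ‖h‖₊ (hmaps.restrict f s s) :=
    ⟨hlt, .of_dist_le_mul fun u v => by
      simpa [Subtype.dist_eq, dist_eq_norm] using hlip u u.2 v v.2⟩
  obtain ⟨u, ⟨-, husa⟩, hfix, -⟩ := hcontract.exists_fixedPoint' hcomplete hmaps (x := 0)
    ⟨by simp, .zero A⟩ (edist_ne_top _ _)
  exact ⟨u, husa, ((inv_smul_eq_iff₀ two_ne_zero).1 hfix.eq).symm⟩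

theorem exists_isSelfAdjoint_mul_self_eq_one_sub {h : A} (hh : IsSelfAdjoint h) (hlt : ‖h‖ < 1) :
    ∃ k : A, IsSelfAdjoint k ∧ k * k = 1 - h := by
  obtain ⟨u, husa, hu⟩ := exists_isSelfAdjoint_two_smul_eq_add_mul_self hh hlt
  refine ⟨1 - u, .sub (.one A) husa, ?_⟩
  rw [two_smul] at hu
  rw [eq_sub_of_add_eq hu.symm]
  noncomm_ring

end SquareRoot

theorem inner_map_star_mul_apply {𝕜 A H : Type*} [RCLike 𝕜] [Semiring A] [Algebra 𝕜 A] [Star A]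
    [NormedAddCommGroup H] [InnerProductSpace 𝕜 H] [CompleteSpace H] (π : A →⋆ₐ[𝕜] (H →L[𝕜] H))
    (x y : A) (η ζ : H) : inner 𝕜 η (π (star x * y) ζ) = inner 𝕜 (π x η) (π y ζ) := by
  rw [map_mul, map_star, ContinuousLinearMap.star_eq_adjoint, mul_apply_eq_comp,
    ContinuousLinearMap.adjoint_inner_right]

section PositiveFunctional

variable {𝕜 A : Type*} [RCLike 𝕜] [NormedRing A] [StarRing A] [CompleteSpace A] [CStarRing A]
  [NormedAlgebra 𝕜 A] [StarModule 𝕜 A]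

open Filter Topology in
theorem re_map_star_mul_self_le_of_nonneg (g : A →ₗ[𝕜] 𝕜)
    (hg : ∀ k, 0 ≤ RCLike.re (g (star k * k))) (x : A) :
    RCLike.re (g (star x * x)) ≤ ‖x‖ ^ 2 * RCLike.re (g 1) := by
  let _ : NormedAlgebra ℝ A := NormedAlgebra.restrictScalars ℝ 𝕜 A
  have : IsScalarTower ℝ 𝕜 A := IsScalarTower.of_algebraMap_smul fun _ _ => rfl
  have : StarModule ℝ A := starModule_real 𝕜
  have hbound : ∀ s : ℝ, ‖x‖ ^ 2 < s → RCLike.re (g (star x * x)) ≤ s * RCLike.re (g 1) := by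
    intro s hs
    have hpos : 0 < s := (sq_nonneg _).trans_lt hs
    have hlt : ‖s⁻¹ • (star x * x)‖ < 1 := by
      rwa [norm_smul, CStarRing.norm_star_mul_self, norm_inv, Real.norm_of_nonneg hpos.le, ← sq,
        inv_mul_lt_one₀ hpos]
    obtain ⟨k, hk, hkk⟩ := exists_isSelfAdjoint_mul_self_eq_one_sub
      (.smul (.all s⁻¹) (.star_mul_self x)) hlt
    have hnonneg := hg k
    rwa [hk.star_eq, hkk, map_sub, ← algebraMap_smul 𝕜 s⁻¹, map_smul, smul_eq_mul,
      RCLike.algebraMap_eq_ofReal, map_sub, RCLike.re_ofReal_mul, sub_nonneg,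
      inv_mul_le_iff₀ hpos] at hnonneg
  have hlim : Tendsto (fun s : ℝ => s * RCLike.re (g 1)) (𝓝[>] (‖x‖ ^ 2))
      (𝓝 (‖x‖ ^ 2 * RCLike.re (g 1))) :=
    ((continuous_mul_const _).tendsto _).mono_left nhdsWithin_le_nhds
  exact ge_of_tendsto hlim (eventually_nhdsWithin_of_forall hbound)

variable {H : Type*} [NormedAddCommGroup H] [InnerProductSpace 𝕜 H] [CompleteSpace H]

theorem norm_starAlgHom_apply_le (π : A →⋆ₐ[𝕜] (H →L[𝕜] H)) (x : A) (η : H) :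
    ‖π x η‖ ≤ ‖x‖ * ‖η‖ := by
  let g : A →ₗ[𝕜] 𝕜 := (innerSL 𝕜 η : H →ₗ[𝕜] 𝕜) ∘ₗ
    (ContinuousLinearMap.apply 𝕜 H η : (H →L[𝕜] H) →ₗ[𝕜] H) ∘ₗ (π : A →ₗ[𝕜] (H →L[𝕜] H))
  have hg : ∀ z, g z = inner 𝕜 η (π z η) := fun _ => rfl
  have hsq : ∀ z, RCLike.re (g (star z * z)) = ‖π z η‖ ^ 2 := fun z => by
    rw [hg, inner_map_star_mul_apply, inner_self_eq_norm_sq]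
  have hle := re_map_star_mul_self_le_of_nonneg g (fun k => hsq k ▸ sq_nonneg _) x
  rw [hsq, hg, map_one, one_apply_eq_self, inner_self_eq_norm_sq, ← mul_pow] at hle
  exact (sq_le_sq₀ (norm_nonneg _) (by positivity)).1 hle

theorem IsCyclicRepresentation.isBJOrthogonalTo {π : A →⋆ₐ[𝕜] (H →L[𝕜] H)} {ξ : H}
    (h : IsCyclicRepresentation π ξ) {a : A} {B : Submodule 𝕜 A} (ha : ‖π a ξ‖ = ‖a‖)
    (hB : ∀ b ∈ B, inner 𝕜 (π a ξ) (π b ξ) = 0) : IsBJOrthogonalTo a B := by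
  intro b hb k
  have hpythagoras := norm_add_sq_eq_norm_sq_add_norm_sq_of_inner_eq_zero (π a ξ) (π (k • b) ξ)
    (hB _ (B.smul_mem k hb))
  calc ‖a‖ = ‖π a ξ‖ := ha.symm
    _ ≤ ‖π a ξ + π (k • b) ξ‖ := by
      rw [mul_self_le_mul_self_iff (norm_nonneg _) (norm_nonneg _), hpythagoras]
      exact le_add_of_nonneg_right (mul_self_nonneg _)
    _ = ‖π (a + k • b) ξ‖ := by rw [map_add, add_apply]
    _ ≤ ‖a + k • b‖ := by
      simpa [h.norm_eq_one] using norm_starAlgHom_apply_le π (a + k • b) ξ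

end PositiveFunctional

section Completion

open UniformSpace

theorem completion_clm_ext {𝕜 V F : Type*} [NormedField 𝕜] [SeminormedAddCommGroup V]
    [NormedSpace 𝕜 V] [AddCommMonoid F] [Module 𝕜 F] [TopologicalSpace F] [T2Space F]
    {f g : Completion V →L[𝕜] F} (h : ∀ x : V, f x = g x) : f = g :=
  DFunLike.coe_injective <| Completion.ext f.continuous g.continuous h

/-- The extension of the bounded operators on a seminormed space to its completion. -/
noncomputable def completionAlgHom (𝕜 V : Type*) [NormedField 𝕜] [SeminormedAddCommGroup V]
    [NormedSpace 𝕜 V] : (V →L[𝕜] V) →ₐ[𝕜] (Completion V →L[𝕜] Completion V) :=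
  AlgHom.ofLinearMap
    { toFun := ContinuousLinearMap.completion
      map_add' _ _ := completion_clm_ext fun _ => by simp [Completion.coe_add]
      map_smul' _ _ := completion_clm_ext fun _ => by simp [Completion.coe_smul] }
    (completion_clm_ext fun _ => by simp)
    (fun _ _ => completion_clm_ext fun _ => by simp)

@[simp]
theorem completionAlgHom_apply_coe {𝕜 V : Type*} [NormedField 𝕜] [SeminormedAddCommGroup V]
    [NormedSpace 𝕜 V] (T : V →L[𝕜] V) (x : V) : completionAlgHom 𝕜 V T x = (T x : Completion V) :=
  T.completion_apply_coe x

variable {𝕜 V A : Type*} [RCLike 𝕜] [SeminormedAddCommGroup V] [InnerProductSpace 𝕜 V]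

theorem completionAlgHom_eq_star {S T : V →L[𝕜] V} (h : ∀ x y, inner 𝕜 (S x) y = inner 𝕜 x (T y)) :
    completionAlgHom 𝕜 V S = star (completionAlgHom 𝕜 V T) := by
  refine (ContinuousLinearMap.eq_adjoint_iff _ _).2 fun x y => ?_
  induction x, y using Completion.induction_on₂ with
  | hp => apply isClosed_eq <;> fun_prop
  | ih x y => simp [h]

/-- The representation on the Hilbert space completion of `V` induced by a representation `ρ` of a
`*`-algebra by bounded operators on `V`. As `V` need not be complete, compatibility of `ρ` with the
involution is expressed through the inner product. -/
noncomputable def completionStarAlgHom [Semiring A] [Algebra 𝕜 A] [Star A]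
    (ρ : A →ₐ[𝕜] (V →L[𝕜] V))
    (hρ : ∀ a x y, inner 𝕜 (ρ (star a) x) y = inner 𝕜 x (ρ a y)) :
    A →⋆ₐ[𝕜] (Completion V →L[𝕜] Completion V) where
  __ := (completionAlgHom 𝕜 V).comp ρ
  map_star' a := completionAlgHom_eq_star (hρ a)

end Completion

namespace IsState

variable {𝕜 A : Type*} [RCLike 𝕜] [NormedRing A] [StarRing A] [NormedAlgebra 𝕜 A]
  {φ : A →ₗ[𝕜] 𝕜}

theorem re_map_star_mul_self_nonneg (hφ : IsState φ) (x : A) : 0 ≤ RCLike.re (φ (star x * x)) := by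
  obtain ⟨r, hr, heq⟩ := hφ.map_nonneg _ ⟨x, rfl⟩
  rwa [heq, RCLike.ofReal_re]

theorem im_map_star_mul_self (hφ : IsState φ) (x : A) : RCLike.im (φ (star x * x)) = 0 := by
  obtain ⟨r, -, heq⟩ := hφ.map_nonneg _ ⟨x, rfl⟩
  rw [heq, RCLike.ofReal_im]

theorem im_map_add_star (hφ : IsState φ) (x : A) : RCLike.im (φ (x + star x)) = 0 := by
  have hexpand : star (1 + x) * (1 + x) = 1 + (x + star x) + star x * x := by
    rw [star_add, star_one]
    noncomm_ring
  have him := hφ.im_map_star_mul_self (1 + x)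
  rwa [hexpand, map_add, map_add RCLike.im, hφ.im_map_star_mul_self, add_zero, map_add,
    map_add RCLike.im, hφ.map_one, RCLike.one_im, zero_add] at him

variable [StarModule 𝕜 A]

protected theorem map_star (hφ : IsState φ) (x : A) : φ (star x) = star (φ x) := by
  rcases RCLike.I_eq_zero_or_im_I_eq_one (K := 𝕜) with hI | hI
  · rw [hφ.map_star_of_real hI, RCLike.star_def, eq_comm, RCLike.conj_eq_iff_im,
      RCLike.im_eq_zero hI]
  · have him := hφ.im_map_add_star x
    have hre := hφ.im_map_add_star ((RCLike.I : 𝕜) • x)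
    simp only [star_smul, RCLike.star_def, RCLike.conj_I, map_add, map_smul, smul_eq_mul,
      RCLike.mul_im, RCLike.I_re, hI, map_neg] at him hre
    refine RCLike.ext ?_ ?_
    · rw [RCLike.star_def, RCLike.conj_re]; linarith
    · rw [RCLike.star_def, RCLike.conj_im]; linarith

/-- The algebra `A` with the positive semidefinite inner product `⟪x, y⟫ = φ (x* y)` of a state `φ`.
It is a type synonym because `A` already carries its C*-norm. -/
def PreHilbert (_ : IsState φ) : Type _ := A

variable (hφ : IsState φ)

noncomputable instance : AddCommGroup hφ.PreHilbert := inferInstanceAs (AddCommGroup A)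

noncomputable instance : Module 𝕜 hφ.PreHilbert := inferInstanceAs (Module 𝕜 A)

/-- The identity map from `A` to its type synonym `PreHilbert`. -/
def toPreHilbert : A ≃ₗ[𝕜] hφ.PreHilbert := LinearEquiv.refl 𝕜 A

/-- The positive semidefinite form `⟪x, y⟫ = φ (x* y)` of a state `φ`. -/
noncomputable abbrev preInnerCore : PreInnerProductSpace.Core 𝕜 hφ.PreHilbert where
  inner x y := φ (star (hφ.toPreHilbert.symm x) * hφ.toPreHilbert.symm y)
  conj_inner_symm x y := by rw [← RCLike.star_def, ← hφ.map_star, star_mul, star_star]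
  re_inner_nonneg x := hφ.re_map_star_mul_self_nonneg _
  add_left x y z := by rw [map_add, star_add, add_mul, map_add]
  smul_left x y r := by simp

noncomputable instance : SeminormedAddCommGroup hφ.PreHilbert :=
  InnerProductSpace.Core.toSeminormedAddCommGroup (c := hφ.preInnerCore)

noncomputable instance : InnerProductSpace 𝕜 hφ.PreHilbert :=
  InnerProductSpace.ofCore hφ.preInnerCore

theorem inner_toPreHilbert (x y : A) :
    inner 𝕜 (hφ.toPreHilbert x) (hφ.toPreHilbert y) = φ (star x * y) := rfl

theorem norm_toPreHilbert_sq (x : A) : ‖hφ.toPreHilbert x‖ ^ 2 = RCLike.re (φ (star x * x)) := by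
  rw [← inner_self_eq_norm_sq (𝕜 := 𝕜), inner_toPreHilbert]

variable [CompleteSpace A] [CStarRing A]

theorem norm_toPreHilbert_mul_le (a x : A) :
    ‖hφ.toPreHilbert (a * x)‖ ≤ ‖a‖ * ‖hφ.toPreHilbert x‖ := by
  let g : A →ₗ[𝕜] 𝕜 := φ ∘ₗ LinearMap.mulLeft 𝕜 (star x) ∘ₗ LinearMap.mulRight 𝕜 x
  have hg : ∀ b, RCLike.re (g (star b * b)) = ‖hφ.toPreHilbert (b * x)‖ ^ 2 := fun b => by
    simp [g, norm_toPreHilbert_sq, mul_assoc]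
  have hg_one : RCLike.re (g 1) = ‖hφ.toPreHilbert x‖ ^ 2 := by
    simp [g, norm_toPreHilbert_sq]
  have hle := re_map_star_mul_self_le_of_nonneg g (fun b => hg b ▸ sq_nonneg _) a
  rw [hg, hg_one, ← mul_pow] at hle
  exact (sq_le_sq₀ (norm_nonneg _) (by positivity)).1 hle

/-- Left multiplication by `a` on the pre-Hilbert space of a state. -/
noncomputable def leftMul (a : A) : hφ.PreHilbert →L[𝕜] hφ.PreHilbert :=
  (hφ.toPreHilbert.conj (LinearMap.mulLeft 𝕜 a)).mkContinuous ‖a‖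
    fun x => hφ.norm_toPreHilbert_mul_le a (hφ.toPreHilbert.symm x)

@[simp]
theorem leftMul_apply (a : A) (x : hφ.PreHilbert) :
    hφ.leftMul a x = hφ.toPreHilbert (a * hφ.toPreHilbert.symm x) := rfl

/-- The left regular representation of `A` on the pre-Hilbert space of a state. -/
noncomputable def leftRegularRep : A →ₐ[𝕜] (hφ.PreHilbert →L[𝕜] hφ.PreHilbert) :=
  AlgHom.ofLinearMap
    { toFun := hφ.leftMul
      map_add' a b := by ext x; simp [add_mul]
      map_smul' c a := by ext x; simp }
    (by ext x; simp)
    (fun a b => by ext x; simp [mul_assoc])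

theorem leftRegularRep_toPreHilbert (a x : A) :
    hφ.leftRegularRep a (hφ.toPreHilbert x) = hφ.toPreHilbert (a * x) := rfl

theorem inner_leftRegularRep_star (a : A) (x y : hφ.PreHilbert) :
    inner 𝕜 (hφ.leftRegularRep (star a) x) y = inner 𝕜 x (hφ.leftRegularRep a y) := by
  obtain ⟨x, rfl⟩ := hφ.toPreHilbert.surjective x
  obtain ⟨y, rfl⟩ := hφ.toPreHilbert.surjective y
  simp only [leftRegularRep_toPreHilbert, inner_toPreHilbert, star_mul, star_star, mul_assoc]

open UniformSpace

/-- The Gelfand–Naimark–Segal representation of a state. -/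
noncomputable def gnsRep :
    A →⋆ₐ[𝕜] (Completion hφ.PreHilbert →L[𝕜] Completion hφ.PreHilbert) :=
  completionStarAlgHom hφ.leftRegularRep hφ.inner_leftRegularRep_star

/-- The cyclic vector of the Gelfand–Naimark–Segal representation: the class of `1`. -/
noncomputable def gnsVector : Completion hφ.PreHilbert := hφ.toPreHilbert 1

theorem gnsRep_gnsVector (a : A) : hφ.gnsRep a hφ.gnsVector = hφ.toPreHilbert a := by
  change completionAlgHom 𝕜 _ (hφ.leftRegularRep a) (hφ.toPreHilbert 1) = _
  rw [completionAlgHom_apply_coe, leftRegularRep_toPreHilbert, mul_one]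

theorem inner_gnsRep_gnsVector (a b : A) :
    inner 𝕜 (hφ.gnsRep a hφ.gnsVector) (hφ.gnsRep b hφ.gnsVector) = φ (star a * b) := by
  rw [gnsRep_gnsVector, gnsRep_gnsVector, Completion.inner_coe, inner_toPreHilbert]

theorem norm_gnsRep_gnsVector_sq (a : A) :
    ‖hφ.gnsRep a hφ.gnsVector‖ ^ 2 = RCLike.re (φ (star a * a)) := by
  rw [← inner_self_eq_norm_sq (𝕜 := 𝕜), inner_gnsRep_gnsVector]

theorem isCyclicRepresentation_gnsRep : IsCyclicRepresentation hφ.gnsRep hφ.gnsVector where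
  norm_eq_one := by
    rw [← sq_eq_sq₀ (norm_nonneg _) zero_le_one, one_pow]
    simpa only [_root_.map_one, one_apply_eq_self, star_one, mul_one, hφ.map_one, RCLike.one_re]
      using hφ.norm_gnsRep_gnsVector_sq 1
  dense_orbit := by
    refine Completion.denseRange_coe.mono ?_
    rintro _ ⟨x, rfl⟩
    exact ⟨hφ.toPreHilbert.symm x, by rw [gnsRep_gnsVector, LinearEquiv.apply_symm_apply]⟩

end IsState

theorem mainTheorem1 {𝕜 : Type v} [RCLike 𝕜] {A : Type u} [NormedRing A] [StarRing A]
    [CompleteSpace A] [CStarRing A] [NormedAlgebra 𝕜 A] [StarModule 𝕜 A]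
    [IsUnitalCStarAlgebra 𝕜 A] [Nontrivial A]
    (a : A) (B : Submodule 𝕜 A) :
    List.TFAE [
      IsBJOrthogonalTo a B,
      ∃ φ : A →ₗ[𝕜] 𝕜, IsState φ ∧
        φ (star a * a) = ((‖a‖ ^ 2 : ℝ) : 𝕜) ∧ ∀ b ∈ B, φ (star a * b) = 0,
      ∃ (H : Type u) (_ : NormedAddCommGroup H) (_ : InnerProductSpace 𝕜 H) (_ : CompleteSpace H)
        (π : A →⋆ₐ[𝕜] (H →L[𝕜] H)) (ξ : H), IsCyclicRepresentation π ξ ∧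
        ‖π a ξ‖ = ‖a‖ ∧ ∀ b ∈ B, inner 𝕜 (π a ξ) (π b ξ) = 0] := by
  tfae_have 1 → 2 := IsBJOrthogonalTo.exists_isState
  tfae_have 2 → 3 := by
    rintro ⟨φ, hφ, ha, hB⟩
    have hnorm : ‖hφ.gnsRep a hφ.gnsVector‖ = ‖a‖ := by
      rw [← sq_eq_sq₀ (norm_nonneg _) (norm_nonneg _), hφ.norm_gnsRep_gnsVector_sq, ha,
        RCLike.ofReal_re]
    exact ⟨_, _, _, inferInstance, hφ.gnsRep, hφ.gnsVector, hφ.isCyclicRepresentation_gnsRep, hnorm,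
      fun b hb => by rw [hφ.inner_gnsRep_gnsVector, hB b hb]⟩
  tfae_have 3 → 1 := by
    rintro ⟨H, _, _, _, π, ξ, hπ, ha, hB⟩
    exact hπ.isBJOrthogonalTo ha hB
  tfae_finish
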